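/- **Setting.** Let $N\ge 2$ agents $\mathcal N=\{1,\dots,N\}$ be the vertices of a strongly connected directed graph $\mathcal G$ without self-loops, with out-neighborhoods $\mathcal N(i)$. Let $d(i,r)$ be the length of a shortest directed path from $i$ to $r$; for $r\neq i$ let $n(i,r)\in\mathcal N(i)$ be an out-neighbor with $d(n(i,r),r)=d(i,r)-1$, and let $n(i,i)\in\mathcal N(i)$ be arbitrary. Let $\eta>1$. A single divisible good of total amount $c\in\mathbb R$ is to be shared; agent $i$ has a $C^2$ valuation $v_i:\mathbb R\to\mathbb R$ with $v_i''(x)\in(-\eta,-1/\eta)$ for all $x$. The efficient allocation is the unique maximizer $x^*$ of $\sum_i v_i(x_i)$ subject to $\sum_i x_i=c$. **Game $\mathfrak G_{pvt}$.** Agent $i$ sends $m_i=(y_i,q_i)\in\mathcal M_i=\mathbb R\times\mathbb R^N$, $q_i=(q_i^1,\dots,q_i^N)$; $\mathcal M=\prod_i\mathcal M_i$. For parameters $\xi\in(0,1)$, $\delta>0$ put $$S_i(m)=\sum_{r\in\mathcal N(i)}\frac{q_r^r}{\xi}+\sum_{r\notin\mathcal N(i),\,r\ne i}\frac{q^r_{n(i,r)}}{\xi^{d(i,r)-1}},\qquad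 \hat x_i(m)=y_i-\frac{S_i(m)}{N-1}+\frac cN,\qquad \hat p_i(m)=\frac1\delta\Big(\frac{q^i_{n(i,i)}}{\xi}+S_i(m)\Big),$$ $$\hat t_i(m)=\hat p_i(m)\Big(\hat x_i(m)-\frac cN\Big)+(q_i^i-\xi y_i)^2+\sum_{r\in\mathcal N(i)}(q_i^r-\xi y_r)^2+\sum_{r\notin\mathcal N(i),\,r\neq i}\big(q_i^r-\xi q^r_{n(i,r)}\big)^2 .$$ The payoff of agent $i$ is $u_i(m)=v_i(\hat x_i(m))-\hat t_i(m)$. **ABR dynamics.** Let $\|\cdot\|_d$ be a norm on $\mathcal M$, $\beta:\mathcal M\to\mathcal M$ the best-response map and $\tilde m\in\mathcal M$. For $A\subseteq\mathcal M$ let $B(A)$ be the smallest closed $\|\cdot\|_d$-ball centered at $\tilde m$ that contains $A$ (all of $\mathcal M$ if $A$ is unbounded). Mixed strategy profiles $\mu_k$ of product form, with supports $S(\mu_k)\subseteq\mathcal M$ and realized profiles $m_k\in S(\mu_k)$, form an Adaptive Best-Response (ABR) dynamic if for every $k_0$ there is $k_1>k_0$ with $S(\mu_k)\subseteq B(\beta(B(\{m_{k_0},\dots,m_{k-1}\})))$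 for all $k\ge k_1$. **Theorem.** There is $\xi_0\in(0,1)$, depending only on $\mathcal G$, $n$, $\eta$, such that for every $\xi\in(\xi_0,1)$ there are $\delta>0$ and a norm $\|\cdot\|_d$ on $\mathcal M$, which for $N\ge3$ is the sup norm, such that for all $c$ and all valuations $v_1,\dots,v_N$ as above: 1. every agent has exactly one best response to every profile of messages of the others; the resulting best-response map $\beta=(\hat y_i,\hat q_i)_i$ is differentiable and is a contraction: $\|\beta(x)-\beta(y)\|_d\le\kappa\|x-y\|_d$ for all $x,y$, with some $\kappa<1$; 2. if $N\ge3$, the row-sum norm of the Jacobian of $\beta$ is at most some $\kappa'<1$ on all of $\mathcal M$; 3. for every $i$, $\hat y_i$ and $\hat q_i^{\,i}$ are strictly decreasing in $q^i_{n(i,i)}$. Hence the best responses are not nondecreasing in the messages of the other agents, and the game is not supermodular (that is, it is not true that each $u_i$ is supermodular in $m_i$ with increasing differences in $(m_i,m_{-i})$, for the componentwise order); 4. there is exactly one Nash equilibrium $\tilde m$; if $i\in\mathcal N(n(i,i))$ for all $i$ (which is automatic when $\mathcal G$ is undirected), then it is efficient: $\hat x(\tilde m)=x^*$; 5. for every ABR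 dynamic (with respect to $\|\cdot\|_d$, $\beta$ and $\tilde m$), the realized profiles $m_k$ converge to $\tilde m$, and the supports $S(\mu_k)$ are eventually contained in every neighborhood of $\tilde m$. -/

import Mathlib

open Filter Topology MeasureTheory

noncomputable section

namespace PrivateGoods

/-! ### The communication graph -/

/-- There is a directed walk with `k` edges from `i` to `j`. -/
def HasWalk {V : Type*} (G : Digraph V) : ℕ → V → V → Prop
  | 0, i, j => i = j
  | k + 1, i, j => ∃ l, G.Adj i l ∧ HasWalk G k l j

/-- The length of a shortest directed path from `i` to `j`. -/
def ddist {V : Type*} (G : Digraph V) (i j : V) : ℕ :=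
  sInf {k | HasWalk G k i j}

/-- Every vertex can be reached from every vertex along directed edges. -/
def StronglyConnected {V : Type*} (G : Digraph V) : Prop :=
  ∀ i j, Relation.ReflTransGen G.Adj i j

/-- `n i j` (for `j ≠ i`) is an out-neighbor of `i` through which a shortest path from `i` to `j`
goes, and `n i i` is an arbitrary out-neighbor of `i`. -/
structure IsNextHop {V : Type*} (G : Digraph V) (n : V → V → V) : Prop where
  adj : ∀ i j, G.Adj i (n i j)
  dist_succ : ∀ i j, j ≠ i → ddist G (n i j) j + 1 = ddist G i j

/-! ### The mechanism and the induced game -/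

/-- A message `(y, q)`: a demand `y` and proxies `q r` for the demands of all agents `r`. -/
abbrev Message (N : ℕ) : Type := ℝ × (Fin N → ℝ)

/-- Message profiles; `(m i).1` is `y_i` and `(m i).2 r` is `q_i^r`. -/
abbrev Profile (N : ℕ) : Type := Fin N → Message N

/-- The data from which the mechanism is built: graph `G`, next-hop map `n`, total available
amount `c`, and the two design parameters. -/
structure Design (N : ℕ) where
  G : Digraph (Fin N)
  n : Fin N → Fin N → Fin N
  c : ℝ
  ξ : ℝ
  δ : ℝ

variable {N : ℕ}

open Classical in
/-- The allocation `x̂_i(m)`. -/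
def Design.alloc (D : Design N) (m : Profile N) (i : Fin N) : ℝ :=
  (m i).1
    - 1 / ((N : ℝ) - 1) * ∑ r with D.G.Adj i r, (m r).2 r / D.ξ
    - 1 / ((N : ℝ) - 1) *
        ∑ r with ¬ D.G.Adj i r ∧ r ≠ i, (m (D.n i r)).2 r / D.ξ ^ (ddist D.G i r - 1)
    + D.c / N

open Classical in
/-- The price `p̂_i(m)`, which does not depend on the message of agent `i`. -/
def Design.price (D : Design N) (m : Profile N) (i : Fin N) : ℝ :=
  1 / D.δ *
    ((m (D.n i i)).2 i / D.ξ
      + ∑ r with D.G.Adj i r, (m r).2 r / D.ξ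
      + ∑ r with ¬ D.G.Adj i r ∧ r ≠ i, (m (D.n i r)).2 r / D.ξ ^ (ddist D.G i r - 1))

open Classical in
/-- The tax `t̂_i(m)`. -/
def Design.tax (D : Design N) (m : Profile N) (i : Fin N) : ℝ :=
  D.price m i * (D.alloc m i - D.c / N)
    + ((m i).2 i - D.ξ * (m i).1) ^ 2
    + ∑ r with D.G.Adj i r, ((m i).2 r - D.ξ * (m r).1) ^ 2
    + ∑ r with ¬ D.G.Adj i r ∧ r ≠ i, ((m i).2 r - D.ξ * (m (D.n i r)).2 r) ^ 2

/-- The payoff `u_i(m) = v_i(x̂_i(m)) - t̂_i(m)` of agent `i` in the induced game. -/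
def Design.payoff (D : Design N) (v : Fin N → ℝ → ℝ) (i : Fin N) (m : Profile N) : ℝ :=
  v i (D.alloc m i) - D.tax m i

/-- The valuations of the model: twice continuously differentiable with second derivative in
`(-η, -1/η)`; strict concavity is a consequence. -/
def IsValuation (η : ℝ) (v : ℝ → ℝ) : Prop :=
  ContDiff ℝ 2 v ∧ ∀ x, deriv (deriv v) x ∈ Set.Ioo (-η) (-(1 / η))

/-- `x` solves: maximize `∑ v_i(x_i)` subject to `∑ x_i = c`. -/
def IsEfficient (c : ℝ) (v : Fin N → ℝ → ℝ) (x : Fin N → ℝ) : Prop :=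
  ∑ i, x i = c ∧ ∀ x' : Fin N → ℝ, ∑ i, x' i = c → ∑ i, v i (x' i) ≤ ∑ i, v i (x i)

/-! ### Games on message profiles -/

/-- The set of best responses of agent `i` to the messages of the other agents in `m`. -/
def bestResponses (u : Fin N → Profile N → ℝ) (i : Fin N) (m : Profile N) : Set (Message N) :=
  {a | ∀ b, u i (Function.update m i b) ≤ u i (Function.update m i a)}

/-- The best response of every agent is unique, and `β m i` is that of agent `i`. -/
def IsBestResponseMap (u : Fin N → Profile N → ℝ) (β : Profile N → Profile N) : Prop :=
  ∀ i m, bestResponses u i m = {β m i}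

/-- Nash equilibrium in pure messages. -/
def IsNash (u : Fin N → Profile N → ℝ) (m : Profile N) : Prop :=
  ∀ i b, u i (Function.update m i b) ≤ u i m

/-- Supermodular game for the componentwise order: every payoff is supermodular in the own message
and has increasing differences in the own message and those of the other agents. -/
def IsSupermodular (u : Fin N → Profile N → ℝ) : Prop :=
  ∀ i, (∀ m a b, u i (Function.update m i a) + u i (Function.update m i b) ≤
      u i (Function.update m i (a ⊓ b)) + u i (Function.update m i (a ⊔ b))) ∧
    (∀ m m' : Profile N, m ≤ m' → ∀ a b, a ≤ b →
      u i (Function.update m i b) - u i (Function.update m i a) ≤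
        u i (Function.update m' i b) - u i (Function.update m' i a))

/-- The best response of every agent `i` is nondecreasing in the message of every other agent. -/
def BestResponseNondecreasing (β : Profile N → Profile N) : Prop :=
  ∀ i j, j ≠ i → ∀ (m : Profile N) (a b : Message N), a ≤ b →
    β (Function.update m j a) i ≤ β (Function.update m j b) i

/-- The profile `m` with the entry `q_j^r` replaced by `t`. -/
def setProxy (m : Profile N) (j r : Fin N) (t : ℝ) : Profile N :=
  Function.update m j ((m j).1, Function.update (m j).2 r t)

/-! ### Contraction and the row-sum norm -/

/-- `h` is a contraction for the metric `p (x - y)`, with a constant `κ < 1`. -/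
def IsContraction (p : Seminorm ℝ (Profile N)) (h : Profile N → Profile N) : Prop :=
  ∃ κ : ℝ, 0 ≤ κ ∧ κ < 1 ∧ ∀ x y, p (h x - h y) ≤ κ * p (x - y)

/-- The sum of the absolute values of all partial derivatives of `g : Profile N → ℝ` at `m`. -/
def rowSum (g : Profile N → ℝ) (m : Profile N) : ℝ :=
  ∑ j, (|fderiv ℝ g m (Pi.single j (1, 0))| +
    ∑ r, |fderiv ℝ g m (Pi.single j (0, Pi.single r 1))|)

/-- The row-sum norm of the Jacobian of `h` at `m`: the largest row sum, over the rows
belonging to the components `y_i` and `q_i^w`. -/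
def jacobianRowSumNorm (h : Profile N → Profile N) (m : Profile N) : ℝ :=
  ⨆ i, max (rowSum (fun x => (h x i).1) m) (⨆ w, rowSum (fun x => (h x i).2 w) m)

/-! ### Adaptive best-response dynamics -/

/-- The smallest closed ball (for the metric `p (x - y)`) centered at `z` that contains `A`, as the
intersection of all of them; it is the whole space when `A` is unbounded. -/
def ballHull (p : Seminorm ℝ (Profile N)) (z : Profile N) (A : Set (Profile N)) :
    Set (Profile N) :=
  {x | ∀ ρ : ℝ, (∀ a ∈ A, p (a - z) ≤ ρ) → p (x - z) ≤ ρ}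

/-- The support of the product of the mixed strategies `μ i`. -/
def mixedSupport (μ : Fin N → ProbabilityMeasure (Message N)) : Set (Profile N) :=
  (Measure.pi fun i => (μ i : Measure (Message N))).support

/-- The mixed strategy profiles `μ 0, μ 1, …` used along a play with realized profiles
`m 0, m 1, …` form an adaptive best-response dynamic, for the best-response map `β`, the
equilibrium `z` and the metric `p (x - y)`. -/
def IsABR (p : Seminorm ℝ (Profile N)) (β : Profile N → Profile N) (z : Profile N)
    (μ : ℕ → Fin N → ProbabilityMeasure (Message N)) (m : ℕ → Profile N) : Prop :=
  (∀ k, m k ∈ mixedSupport (μ k)) ∧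
    ∀ k₀, ∃ k₁ > k₀, ∀ k ≥ k₁,
      mixedSupport (μ k) ⊆ ballHull p z (β '' ballHull p z (m '' Set.Ico k₀ k))

end PrivateGoods

end

/-!
The best response of agent `i` can be written down explicitly. The messages of the others enter the
payoff of `i` only through the price, the reported demands `S_i` and the quantities that `i` is
asked to imitate, so `i` maximizes a strictly concave function of the allocation minus a sum of
squares: the allocation is `g_i(p_i)` with `g_i = (v_i')⁻¹`, and every square is made zero
(`Design.isBestResponseMap_reply`). The derivative of `g_i` lies in `(-η, -1/η)`; hence, with
`γ ∈ (1/(ηδ), η/δ)` and `T_i` the demand of `i` as echoed to `i`, the demand `y_i` changes by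
`-γ ΔT_i + (1/(N-1) - γ) ΔS_i` (`Design.replyDemand_sub`). As `T_i` does not occur in `S_i`, this
gives at once the monotonicity claims.

*Contraction, `N ≥ 3`.* If `γ ≤ 1/(N-1)`, the row of `y_i` has absolute sum close to
`γ + 1 - (N-1)γ = 1 - (N-2)γ < 1` for `ξ` near `1`, and all other rows carry an additional factor
`ξ` (`Design.norm_reply_sub_le`). A Lipschitz constant for the sup norm bounds the row sums of the
Jacobian, since a row sum is the value of the derivative at a vector of signs
(`rowSum_le_norm_fderiv`).

*Contraction, `N = 2`.* The row sum above is at least `1`, and no rescaling of the message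
coordinates helps. But `ξ y_i` changes by `(1 - 2γ) Δq_j^j + γ Δ(q_j^j - q_j^i)`, and `ξ y_i - q_i^i` vanishes
after one step, while `q_i^i - q_i^j` depends on `q_j^j` and `q_j^j - q_j^i` only through terms of
order `γ`: in the coordinates `q_i^i`, `q_i^i - q_i^j`, `4 (ξ y_i - q_i^i)` the sup norm is
contracted as soon as `γ ≤ 1/6` (`Design.norm_pairCoords_reply_sub_le`).

*Consequences.* Nash equilibria are the fixed points of the contraction. At a fixed point a proxy
for `y_r` has been multiplied by `ξ` once for every step from `r`
(`Design.proxy_eq_of_reply_eq`), so `S_i` is the total demand of the others. If moreover `T_i = y_i`,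
then all agents face the same price, marginal valuations agree, and the tangent-line inequality for
the concave valuations gives efficiency (`isEfficient_iff_of_deriv_eq`). In an adaptive
best-response dynamic the play stays bounded, and after finitely many rounds every ball around the
equilibrium that contains the play may be shrunk by the contraction factor (`IsABR.eventually_le`).
-/

namespace PrivateGoods

variable {N : ℕ} {η : ℝ} {v : ℝ → ℝ}

/-! ### Valuations and their demand functions -/

theorem IsValuation.hasDerivAt (h : IsValuation η v) (x : ℝ) : HasDerivAt v (deriv v x) x :=
  (h.1.differentiable (by norm_num) x).hasDerivAt

theorem IsValuation.hasDerivAt_deriv (h : IsValuation η v) (x : ℝ) :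
    HasDerivAt (deriv v) (deriv (deriv v) x) x :=
  (h.1.differentiable_deriv_two x).hasDerivAt

theorem IsValuation.exists_slope (h : IsValuation η v) (x y : ℝ) :
    ∃ s ∈ Set.Ioo (1 / η) η, deriv v y - deriv v x = -s * (y - x) := by
  have key : ∀ a b : ℝ, a < b → ∃ s ∈ Set.Ioo (1 / η) η,
      deriv v b - deriv v a = -s * (b - a) := by
    intro a b hab
    obtain ⟨t, -, ht⟩ := exists_deriv_eq_slope (deriv v) hab
      (fun x _ => (h.hasDerivAt_deriv x).continuousAt.continuousWithinAt)
      (fun x _ => (h.hasDerivAt_deriv x).differentiableAt.differentiableWithinAt)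
    have h2 := h.2 t
    refine ⟨-deriv (deriv v) t, ⟨by linarith [h2.2], by linarith [h2.1]⟩, ?_⟩
    rw [eq_div_iff (by linarith)] at ht
    linarith
  rcases lt_trichotomy x y with hxy | rfl | hxy
  · exact key x y hxy
  · have h2 := h.2 x
    exact ⟨-deriv (deriv v) x, ⟨by linarith [h2.2], by linarith [h2.1]⟩, by simp⟩
  · obtain ⟨s, hs, he⟩ := key y x hxy
    exact ⟨s, hs, by linarith⟩

theorem IsValuation.strictAnti_deriv (h : IsValuation η v) (hη : 0 < η) :
    StrictAnti (deriv v) := by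
  intro x y hxy
  obtain ⟨s, hs, he⟩ := h.exists_slope x y
  have : 0 < s * (y - x) := mul_pos (lt_trans (by positivity) hs.1) (by linarith)
  linarith

theorem IsValuation.surjective_deriv (h : IsValuation η v) (hη : 0 < η) :
    Function.Surjective (deriv v) := by
  have hc : Continuous (deriv v) :=
    continuous_iff_continuousAt.2 fun x => (h.hasDerivAt_deriv x).continuousAt
  have hpos : 0 < 1 / η := by positivity
  refine hc.surjective' ?_ ?_
  · refine tendsto_atTop_mono' _ (f₁ := fun x => deriv v 0 + (1 / η) * (-x)) ?_
      (tendsto_atTop_add_const_left _ _ (tendsto_neg_atBot_atTop.const_mul_atTop hpos))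
    filter_upwards [eventually_le_atBot 0] with x hx
    obtain ⟨s, hs, he⟩ := h.exists_slope 0 x
    nlinarith [mul_le_mul_of_nonneg_right hs.1.le (by linarith : 0 ≤ -x)]
  · refine tendsto_atBot_mono' _ (f₁ := fun x => deriv v 0 + (1 / η) * (-x)) ?_
      (tendsto_atBot_add_const_left _ _
        (tendsto_neg_atTop_atBot.const_mul_atBot hpos))
    filter_upwards [eventually_ge_atTop 0] with x hx
    obtain ⟨s, hs, he⟩ := h.exists_slope 0 x
    nlinarith [mul_le_mul_of_nonneg_right hs.1.le hx]

/-- The quantity that an agent with valuation `v` demands at a given price: the inverse of the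
marginal valuation `v'`. -/
noncomputable def demand (v : ℝ → ℝ) : ℝ → ℝ := Function.invFun (deriv v)

theorem IsValuation.deriv_demand (h : IsValuation η v) (hη : 0 < η) (p : ℝ) :
    deriv v (demand v p) = p :=
  Function.rightInverse_invFun (h.surjective_deriv hη) p

theorem IsValuation.demand_slope (h : IsValuation η v) (hη : 0 < η) (p p' : ℝ) :
    ∃ s ∈ Set.Ioo (1 / η) η, demand v p' - demand v p = -s * (p' - p) := by
  obtain ⟨s, hs, he⟩ := h.exists_slope (demand v p) (demand v p')
  rw [h.deriv_demand hη, h.deriv_demand hη] at he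
  have hs0 : 0 < s := lt_trans (by positivity) hs.1
  refine ⟨1 / s, ⟨one_div_lt_one_div_of_lt hs0 hs.2, ?_⟩, ?_⟩
  · simpa using one_div_lt_one_div_of_lt (by positivity) hs.1
  · rw [he]
    field_simp

theorem IsValuation.strictAnti_demand (h : IsValuation η v) (hη : 0 < η) :
    StrictAnti (demand v) := by
  intro x y hxy
  obtain ⟨s, hs, he⟩ := h.demand_slope hη x y
  have : 0 < s * (y - x) := mul_pos (lt_trans (by positivity) hs.1) (by linarith)
  linarith

theorem IsValuation.differentiable_demand (h : IsValuation η v) (hη : 0 < η) :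
    Differentiable ℝ (demand v) := by
  intro p
  have hl : LipschitzWith η.toNNReal (demand v) := by
    refine LipschitzWith.of_dist_le_mul fun a b => ?_
    obtain ⟨s, hs, he⟩ := h.demand_slope hη b a
    have hs0 : 0 < s := lt_trans (by positivity) hs.1
    rw [Real.dist_eq, Real.dist_eq, he, abs_mul, abs_neg, abs_of_pos hs0,
      Real.coe_toNNReal _ hη.le]
    exact mul_le_mul_of_nonneg_right hs.2.le (abs_nonneg _)
  have hne : deriv (deriv v) (demand v p) ≠ 0 := by
    have := (h.2 (demand v p)).2
    have : 0 < 1 / η := by positivity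
    linarith
  exact (HasDerivAt.of_local_left_inverse hl.continuous.continuousAt
    (h.hasDerivAt_deriv _) hne (Eventually.of_forall (h.deriv_demand hη))).differentiableAt

/-- A valuation lies strictly below its tangents. -/
theorem IsValuation.lt_tangent (h : IsValuation η v) (hη : 0 < η) {x y : ℝ} (hxy : y ≠ x) :
    v y < v x + deriv v x * (y - x) := by
  have hc : ∀ s : Set ℝ, ContinuousOn v s := fun s x _ =>
    (h.hasDerivAt x).continuousAt.continuousWithinAt
  have hd : ∀ s : Set ℝ, DifferentiableOn ℝ v s := fun s x _ =>
    (h.hasDerivAt x).differentiableAt.differentiableWithinAt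
  rcases lt_or_gt_of_ne hxy with hlt | hlt
  · obtain ⟨t, ht, he⟩ := exists_deriv_eq_slope v hlt (hc _) (hd _)
    rw [eq_div_iff (by linarith)] at he
    nlinarith [h.strictAnti_deriv hη ht.2]
  · obtain ⟨t, ht, he⟩ := exists_deriv_eq_slope v hlt (hc _) (hd _)
    rw [eq_div_iff (by linarith)] at he
    nlinarith [h.strictAnti_deriv hη ht.1]

theorem IsValuation.le_tangent (h : IsValuation η v) (hη : 0 < η) (x y : ℝ) :
    v y ≤ v x + deriv v x * (y - x) := by
  rcases eq_or_ne y x with rfl | hxy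
  · simp
  · exact (h.lt_tangent hη hxy).le

/-- Equal marginal valuations characterize the efficient allocation. -/
theorem isEfficient_iff_of_deriv_eq {v : Fin N → ℝ → ℝ} (hv : ∀ i, IsValuation η (v i))
    (hη : 0 < η) {c p : ℝ} {x : Fin N → ℝ} (hx : ∑ i, x i = c)
    (hp : ∀ i, deriv (v i) (x i) = p) (x' : Fin N → ℝ) :
    IsEfficient c v x' ↔ x' = x := by
  have hsum : ∀ w : Fin N → ℝ, ∑ i, w i = c →
      ∑ i, (v i (x i) + deriv (v i) (x i) * (w i - x i)) = ∑ i, v i (x i) := by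
    intro w hw
    simp only [hp]
    rw [Finset.sum_add_distrib, ← Finset.mul_sum, Finset.sum_sub_distrib, hw, hx]
    simp
  constructor
  · rintro ⟨hc, hmax⟩
    by_contra hne
    obtain ⟨j, hj⟩ := Function.ne_iff.1 hne
    have : ∑ i, v i (x' i) < ∑ i, (v i (x i) + deriv (v i) (x i) * (x' i - x i)) :=
      Finset.sum_lt_sum (fun i _ => (hv i).le_tangent hη _ _)
        ⟨j, Finset.mem_univ _, (hv j).lt_tangent hη hj⟩
    rw [hsum x' hc] at this
    exact absurd (hmax x hx) (not_le.2 this)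
  · rintro rfl
    refine ⟨hx, fun w hw => ?_⟩
    rw [← hsum w hw]
    exact Finset.sum_le_sum fun i _ => (hv i).le_tangent hη _ _

/-! ### The row-sum norm of the Jacobian -/

/-- A row sum is the value of the derivative at the vector of signs of the partial derivatives,
which lies in the unit ball of the sup norm. -/
theorem rowSum_le_norm_fderiv (g : Profile N → ℝ) (m : Profile N) :
    rowSum g m ≤ ‖fderiv ℝ g m‖ := by
  set f := fderiv ℝ g m
  let s : Profile N := fun j =>
    ((SignType.sign (f (Pi.single j (1, 0))) : ℝ),
      fun r => (SignType.sign (f (Pi.single j (0, Pi.single r 1))) : ℝ))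
  have hsign : ∀ a : ℝ, ‖((SignType.sign a : SignType) : ℝ)‖ ≤ 1 := by
    intro a
    rcases lt_trichotomy a 0 with h | h | h <;> simp [h]
  have hs : ‖s‖ ≤ 1 := by
    refine (pi_norm_le_iff_of_nonneg zero_le_one).2 fun j => ?_
    refine max_le (hsign _) ((pi_norm_le_iff_of_nonneg zero_le_one).2 fun r => hsign _)
  have hdec : s = ∑ j, (((s j).1) • (Pi.single j ((1 : ℝ), (0 : Fin N → ℝ)) : Profile N) +
      ∑ r, ((s j).2 r) • (Pi.single j ((0 : ℝ), (Pi.single r 1 : Fin N → ℝ)) : Profile N)) := by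
    funext k
    rw [Finset.sum_apply, Finset.sum_eq_single k]
    · ext r
      · simp [Prod.fst_sum]
      · simp [Prod.snd_sum, Finset.sum_apply, Pi.single_apply]
    · intro j _ hj
      simp [hj.symm]
    · simp
  have hval : f s = rowSum g m := by
    conv_lhs => rw [hdec]
    simp only [map_sum, map_add, map_smul, rowSum, smul_eq_mul, s]
    refine Finset.sum_congr rfl fun j _ => ?_
    congr 1
    · exact sign_mul_self _
    · exact Finset.sum_congr rfl fun r _ => sign_mul_self _
  calc rowSum g m = f s := hval.symm
    _ ≤ ‖f s‖ := Real.le_norm_self _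
    _ ≤ ‖f‖ * ‖s‖ := f.le_opNorm s
    _ ≤ ‖f‖ := mul_le_of_le_one_right (norm_nonneg _) hs

/-- For the sup norm, a Lipschitz constant bounds the row-sum norm of the Jacobian. -/
theorem jacobianRowSumNorm_le (hN : 0 < N) {h : Profile N → Profile N} {κ : ℝ} (hκ : 0 ≤ κ)
    (hh : ∀ x y, ‖h x - h y‖ ≤ κ * ‖x - y‖) (m : Profile N) :
    jacobianRowSumNorm h m ≤ κ := by
  have : Nonempty (Fin N) := ⟨⟨0, hN⟩⟩
  have key : ∀ g : Profile N → ℝ, (∀ x y, ‖g x - g y‖ ≤ ‖h x - h y‖) → rowSum g m ≤ κ := by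
    intro g hg
    have hl : LipschitzWith κ.toNNReal g := LipschitzWith.of_dist_le_mul fun x y => by
      rw [dist_eq_norm, dist_eq_norm, Real.coe_toNNReal _ hκ]
      exact (hg x y).trans (hh x y)
    have := norm_fderiv_le_of_lipschitz ℝ (x₀ := m) hl
    rw [Real.coe_toNNReal _ hκ] at this
    exact (rowSum_le_norm_fderiv g m).trans this
  refine ciSup_le fun i => max_le (key _ fun x y => ?_) (ciSup_le fun w => key _ fun x y => ?_)
  · exact (norm_fst_le (h x i - h y i)).trans (norm_le_pi_norm (h x - h y) i)
  · exact (norm_le_pi_norm (h x i - h y i).2 w).trans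
      ((norm_snd_le (h x i - h y i)).trans (norm_le_pi_norm (h x - h y) i))

/-! ### Adaptive best-response dynamics of a contraction -/

/-- Once the realized profiles stay within distance `R` of `z`, the supports are eventually within
distance `κ * R`. -/
theorem mixedSupport_shrink {p : Seminorm ℝ (Profile N)} {β : Profile N → Profile N} {z : Profile N}
    {μ : ℕ → Fin N → ProbabilityMeasure (Message N)} {m : ℕ → Profile N}
    {κ : ℝ} (hκ : 0 ≤ κ) (hβ : ∀ x, p (β x - z) ≤ κ * p (x - z)) {k₀ k₁ : ℕ}
    (hk : ∀ k ≥ k₁, mixedSupport (μ k) ⊆ ballHull p z (β '' ballHull p z (m '' Set.Ico k₀ k)))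
    {R : ℝ} {k : ℕ} (hk₁ : k₁ ≤ k) (hR : ∀ j ≥ k₀, j < k → p (m j - z) ≤ R) :
    ∀ x ∈ mixedSupport (μ k), p (x - z) ≤ κ * R := by
  intro x hx
  refine hk k hk₁ hx _ ?_
  rintro _ ⟨y, hy, rfl⟩
  refine (hβ y).trans (mul_le_mul_of_nonneg_left (hy R ?_) hκ)
  rintro _ ⟨j, hj, rfl⟩
  exact hR j hj.1 hj.2

/-- The realized profiles of the rounds before the first restriction on the supports bound all
later ones. -/
theorem IsABR.exists_bound {p : Seminorm ℝ (Profile N)} {β : Profile N → Profile N}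
    {z : Profile N} {μ : ℕ → Fin N → ProbabilityMeasure (Message N)} {m : ℕ → Profile N}
    (h : IsABR p β z μ m) {κ : ℝ} (hκ : 0 ≤ κ) (hκ1 : κ < 1)
    (hβ : ∀ x, p (β x - z) ≤ κ * p (x - z)) :
    ∃ R, ∀ k, p (m k - z) ≤ R := by
  obtain ⟨k₁, -, hk⟩ := h.2 0
  refine ⟨∑ j ∈ Finset.range k₁, p (m j - z), fun k => ?_⟩
  have hR : 0 ≤ ∑ j ∈ Finset.range k₁, p (m j - z) :=
    Finset.sum_nonneg fun _ _ => apply_nonneg p _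
  induction k using Nat.strong_induction_on with
  | _ k ih =>
    rcases lt_or_ge k k₁ with hlt | hge
    · exact Finset.single_le_sum (f := fun j => p (m j - z)) (fun _ _ => apply_nonneg p _)
        (Finset.mem_range.2 hlt)
    · refine (mixedSupport_shrink hκ hβ hk hge (fun j _ hj => ih j hj) _ (h.1 k)).trans ?_
      exact mul_le_of_le_one_left hR hκ1.le

theorem IsABR.eventually_le {p : Seminorm ℝ (Profile N)} {β : Profile N → Profile N}
    {z : Profile N} {μ : ℕ → Fin N → ProbabilityMeasure (Message N)} {m : ℕ → Profile N}
    (h : IsABR p β z μ m) {κ : ℝ} (hκ : 0 ≤ κ) (hκ1 : κ < 1)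
    (hβ : ∀ x, p (β x - z) ≤ κ * p (x - z)) {ε : ℝ} (hε : 0 < ε) :
    ∀ᶠ k in atTop, ∀ x ∈ mixedSupport (μ k), p (x - z) < ε := by
  obtain ⟨R, hR⟩ := h.exists_bound hκ hκ1 hβ
  have key : ∀ n : ℕ, ∃ k₁, ∀ k ≥ k₁, ∀ x ∈ mixedSupport (μ k), p (x - z) ≤ κ ^ (n + 1) * R := by
    intro n
    induction n with
    | zero =>
      obtain ⟨k₁, -, hk⟩ := h.2 0
      refine ⟨k₁, fun k hk₁ x hx => ?_⟩
      simpa using mixedSupport_shrink hκ hβ hk hk₁ (fun j _ _ => hR j) x hx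
    | succ n ih =>
      obtain ⟨k₀, hk₀⟩ := ih
      obtain ⟨k₁, -, hk⟩ := h.2 k₀
      refine ⟨k₁, fun k hk₁ x hx => ?_⟩
      rw [pow_succ', mul_assoc]
      exact mixedSupport_shrink hκ hβ hk hk₁ (fun j hj _ => hk₀ j hj _ (h.1 j)) x hx
  have hlim : Tendsto (fun n : ℕ => κ ^ (n + 1) * R) atTop (𝓝 0) := by
    simpa using ((tendsto_add_atTop_iff_nat 1).2
      (tendsto_pow_atTop_nhds_zero_of_lt_one hκ hκ1)).mul_const R
  obtain ⟨n, hn⟩ := (hlim.eventually (gt_mem_nhds hε)).exists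
  obtain ⟨k₁, hk⟩ := key n
  exact eventually_atTop.2 ⟨k₁, fun k hk₁ x hx => (hk k hk₁ x hx).trans_lt hn⟩

/-- In finite dimension, convergence in a norm `p` obtained from the sup norm by a linear change
of coordinates is convergence in the product topology. -/
theorem IsABR.tendsto {L : Profile N ≃L[ℝ] Profile N} {p : Seminorm ℝ (Profile N)}
    (hp : ∀ x, p x = ‖L x‖) {β : Profile N → Profile N}
    {z : Profile N} {μ : ℕ → Fin N → ProbabilityMeasure (Message N)} {m : ℕ → Profile N}
    (h : IsABR p β z μ m) {κ : ℝ} (hκ : 0 ≤ κ) (hκ1 : κ < 1)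
    (hβ : ∀ x, p (β x - z) ≤ κ * p (x - z)) :
    Tendsto m atTop (𝓝 z) ∧ ∀ U ∈ 𝓝 z, ∀ᶠ k in atTop, mixedSupport (μ k) ⊆ U := by
  have hU : ∀ U ∈ 𝓝 z, ∀ᶠ k in atTop, mixedSupport (μ k) ⊆ U := by
    intro U hU
    have hV : (fun w => z + L.symm w) ⁻¹' U ∈ 𝓝 (0 : Profile N) := by
      have hc : Continuous fun w => z + L.symm w := by fun_prop
      exact hc.continuousAt.preimage_mem_nhds (by simpa using hU)
    obtain ⟨ε, hε, hball⟩ := Metric.mem_nhds_iff.1 hV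
    filter_upwards [h.eventually_le hκ hκ1 hβ hε] with k hk x hx
    have : L (x - z) ∈ Metric.ball (0 : Profile N) ε := by
      rw [mem_ball_zero_iff, ← hp]
      exact hk x hx
    simpa using hball this
  refine ⟨fun U hUz => ?_, hU⟩
  have : ∀ᶠ k in atTop, m k ∈ U := (hU U hUz).mono fun k hk => hk (h.1 k)
  exact this

/-- The contraction principle for a norm obtained from the sup norm by a linear change of
coordinates. -/
theorem IsContraction.exists_fixedPoint {L : Profile N ≃L[ℝ] Profile N}
    {p : Seminorm ℝ (Profile N)} (hp : ∀ x, p x = ‖L x‖) {β : Profile N → Profile N}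
    (h : IsContraction p β) : ∃ z, ∀ m, β m = m ↔ m = z := by
  obtain ⟨κ, hκ, hκ1, hβ⟩ := h
  have hf : ContractingWith κ.toNNReal (fun w => L (β (L.symm w))) := by
    refine ⟨by rw [← NNReal.coe_lt_coe, Real.coe_toNNReal _ hκ]; exact hκ1,
      LipschitzWith.of_dist_le_mul fun x y => ?_⟩
    rw [dist_eq_norm, dist_eq_norm, Real.coe_toNNReal _ hκ, ← map_sub, ← hp]
    refine (hβ _ _).trans_eq ?_
    rw [hp, ← map_sub, L.apply_symm_apply]
  refine ⟨L.symm (ContractingWith.fixedPoint _ hf), fun m => ⟨fun hm => ?_, ?_⟩⟩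
  · rw [← hf.fixedPoint_unique (x := L m) (by simp [Function.IsFixedPt, hm]),
      L.symm_apply_apply]
  · rintro rfl
    have h1 := hf.fixedPoint_isFixedPt
    rw [Function.IsFixedPt] at h1
    exact L.injective (h1.trans (L.apply_symm_apply _).symm)

/-! ### The mechanism in terms of neighbors' reports -/

open Classical in
/-- The agent from whom `i` learns a proxy for the demand of `r ≠ i`: `r` itself if `r` is an
out-neighbor of `i`, and the next hop towards `r` otherwise. -/
noncomputable def Design.source (D : Design N) (i r : Fin N) : Fin N :=
  if D.G.Adj i r then r else D.n i r

open Classical in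
/-- The number of factors `ξ` that the proxy received from `D.source i r` carries in
equilibrium: a proxy of `r` for its own demand already carries one. -/
noncomputable def Design.hops (D : Design N) (i r : Fin N) : ℕ :=
  if D.G.Adj i r then 1 else ddist D.G i r - 1

/-- The total demand of the other agents as it is reported to `i`; this is `S_i(m)`. -/
noncomputable def Design.reports (D : Design N) (m : Profile N) (i : Fin N) : ℝ :=
  ∑ r ∈ Finset.univ.erase i, (m (D.source i r)).2 r / D.ξ ^ D.hops i r

/-- The demand of `i` as it is reported back to `i` by the neighbor `n i i`. -/
noncomputable def Design.echo (D : Design N) (m : Profile N) (i : Fin N) : ℝ :=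
  (m (D.n i i)).2 i / D.ξ

open Classical in
/-- The quantity that agent `i` imitates, up to the factor `ξ`, with the proxy for `r ≠ i`. -/
noncomputable def Design.target (D : Design N) (m : Profile N) (i r : Fin N) : ℝ :=
  if D.G.Adj i r then (m r).1 else (m (D.n i r)).2 r

open Classical in
theorem sum_erase_ite {G : Digraph (Fin N)} (hloop : ∀ i, ¬ G.Adj i i) (i : Fin N)
    (a b : Fin N → ℝ) :
    ∑ r ∈ Finset.univ.erase i, (if G.Adj i r then a r else b r) =
      ∑ r with G.Adj i r, a r + ∑ r with ¬ G.Adj i r ∧ r ≠ i, b r := by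
  rw [Finset.sum_ite]
  congr 1
  · refine Finset.sum_congr (Finset.ext fun r => ?_) fun _ _ => rfl
    simp only [Finset.mem_filter, Finset.mem_erase, Finset.mem_univ, true_and, and_true,
      and_iff_right_iff_imp]
    rintro h rfl
    exact hloop _ h
  · refine Finset.sum_congr (Finset.ext fun r => ?_) fun _ _ => rfl
    simp [and_comm]

namespace Design

variable {D : Design N}

theorem reports_eq (hloop : ∀ i, ¬ D.G.Adj i i) (m : Profile N) (i : Fin N) :
    open Classical in D.reports m i = ∑ r with D.G.Adj i r, (m r).2 r / D.ξ +
      ∑ r with ¬ D.G.Adj i r ∧ r ≠ i, (m (D.n i r)).2 r / D.ξ ^ (ddist D.G i r - 1) := by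
  classical
  rw [← sum_erase_ite hloop, reports]
  refine Finset.sum_congr rfl fun r _ => ?_
  unfold source hops
  split_ifs <;> simp

theorem alloc_eq (hloop : ∀ i, ¬ D.G.Adj i i) (m : Profile N) (i : Fin N) :
    D.alloc m i = (m i).1 - 1 / ((N : ℝ) - 1) * D.reports m i + D.c / N := by
  rw [reports_eq hloop, alloc]
  ring

theorem price_eq (hloop : ∀ i, ¬ D.G.Adj i i) (m : Profile N) (i : Fin N) :
    D.price m i = 1 / D.δ * (D.echo m i + D.reports m i) := by
  rw [reports_eq hloop, price, echo]
  ring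

theorem tax_eq (hloop : ∀ i, ¬ D.G.Adj i i) (m : Profile N) (i : Fin N) :
    D.tax m i = D.price m i * (D.alloc m i - D.c / N) + ((m i).2 i - D.ξ * (m i).1) ^ 2 +
      ∑ r ∈ Finset.univ.erase i, ((m i).2 r - D.ξ * D.target m i r) ^ 2 := by
  classical
  rw [tax, add_assoc (_ + _), ← sum_erase_ite hloop]
  congr 1
  refine Finset.sum_congr rfl fun r _ => ?_
  unfold target
  split_ifs <;> rfl

theorem next_ne (hn : IsNextHop D.G D.n) (hloop : ∀ i, ¬ D.G.Adj i i) (i r : Fin N) :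
    D.n i r ≠ i := by
  intro he
  have := hn.adj i r
  rw [he] at this
  exact hloop i this

theorem source_ne (hn : IsNextHop D.G D.n) (hloop : ∀ i, ¬ D.G.Adj i i) {i r : Fin N}
    (h : r ≠ i) : D.source i r ≠ i := by
  unfold source
  split_ifs
  · exact h
  · exact next_ne hn hloop i r

theorem reports_update (hn : IsNextHop D.G D.n) (hloop : ∀ i, ¬ D.G.Adj i i) (m : Profile N)
    (i : Fin N) (b : Message N) : D.reports (Function.update m i b) i = D.reports m i := by
  refine Finset.sum_congr rfl fun r hr => ?_
  rw [Function.update_of_ne (source_ne hn hloop (Finset.ne_of_mem_erase hr))]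

theorem echo_update (hn : IsNextHop D.G D.n) (hloop : ∀ i, ¬ D.G.Adj i i) (m : Profile N)
    (i : Fin N) (b : Message N) : D.echo (Function.update m i b) i = D.echo m i := by
  rw [echo, echo, Function.update_of_ne (next_ne hn hloop i i)]

theorem target_update (hn : IsNextHop D.G D.n) (hloop : ∀ i, ¬ D.G.Adj i i) (m : Profile N)
    (i r : Fin N) (hr : r ≠ i) (b : Message N) :
    D.target (Function.update m i b) i r = D.target m i r := by
  rw [target, target, Function.update_of_ne (next_ne hn hloop i r), Function.update_of_ne hr]

/-- The dependence of the payoff on the own message: the others' messages enter only through the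
price, the reports and the imitation targets. -/
theorem payoff_update (hn : IsNextHop D.G D.n) (hloop : ∀ i, ¬ D.G.Adj i i)
    (v : Fin N → ℝ → ℝ) (m : Profile N) (i : Fin N) (b : Message N) :
    D.payoff v i (Function.update m i b) =
      v i (b.1 - 1 / ((N : ℝ) - 1) * D.reports m i + D.c / N) -
        (D.price m i * (b.1 - 1 / ((N : ℝ) - 1) * D.reports m i) + (b.2 i - D.ξ * b.1) ^ 2 +
          ∑ r ∈ Finset.univ.erase i, (b.2 r - D.ξ * D.target m i r) ^ 2) := by
  have hs : ∑ r ∈ Finset.univ.erase i,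
        ((Function.update m i b i).2 r - D.ξ * D.target (Function.update m i b) i r) ^ 2 =
      ∑ r ∈ Finset.univ.erase i, (b.2 r - D.ξ * D.target m i r) ^ 2 := by
    refine Finset.sum_congr rfl fun r hr => ?_
    rw [target_update hn hloop m i r (Finset.ne_of_mem_erase hr), Function.update_self]
  rw [payoff, tax_eq hloop, hs, alloc_eq hloop, price_eq hloop, price_eq hloop,
    reports_update hn hloop, echo_update hn hloop, Function.update_self]
  ring

/-! ### The best-response map -/

/-- The demand `ŷ_i(m)` in the best response of agent `i`; it makes the marginal valuation at the
resulting allocation equal to the price. -/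
noncomputable def replyDemand (D : Design N) (v : Fin N → ℝ → ℝ) (m : Profile N) (i : Fin N) : ℝ :=
  demand (v i) (D.price m i) + 1 / ((N : ℝ) - 1) * D.reports m i - D.c / N

/-- The best response of every agent to the messages of the others. -/
noncomputable def reply (D : Design N) (v : Fin N → ℝ → ℝ) (m : Profile N) : Profile N := fun i =>
  (D.replyDemand v m i, fun r => D.ξ * if r = i then D.replyDemand v m i else D.target m i r)

theorem isBestResponseMap_reply (hn : IsNextHop D.G D.n) (hloop : ∀ i, ¬ D.G.Adj i i)
    (hη : 0 < η) {v : Fin N → ℝ → ℝ} (hv : ∀ i, IsValuation η (v i)) :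
    IsBestResponseMap (D.payoff v) (D.reply v) := by
  intro i m
  -- the loss of a deviation `b`: the concavity gap of `v i` and the squared penalties
  have key : ∀ b : Message N, ∃ x, D.payoff v i (Function.update m i b) =
      D.payoff v i (Function.update m i (D.reply v m i)) +
        (v i x - (v i (demand (v i) (D.price m i)) +
          deriv (v i) (demand (v i) (D.price m i)) * (x - demand (v i) (D.price m i)))) -
        ((b.2 i - D.ξ * b.1) ^ 2 +
          ∑ r ∈ Finset.univ.erase i, (b.2 r - D.ξ * D.target m i r) ^ 2) ∧
      b.1 = D.replyDemand v m i + (x - demand (v i) (D.price m i)) := by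
    intro b
    refine ⟨b.1 - 1 / ((N : ℝ) - 1) * D.reports m i + D.c / N, ?_, ?_⟩
    · have hs : ∑ r ∈ Finset.univ.erase i,
          ((D.reply v m i).2 r - D.ξ * D.target m i r) ^ 2 = 0 := by
        refine Finset.sum_eq_zero fun r hr => ?_
        simp [reply, Finset.ne_of_mem_erase hr]
      have hy : (D.reply v m i).1 - 1 / ((N : ℝ) - 1) * D.reports m i + D.c / N =
          demand (v i) (D.price m i) := by
        simp only [reply, replyDemand]
        ring
      have hq : (D.reply v m i).2 i = D.ξ * (D.reply v m i).1 := by simp [reply]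
      rw [payoff_update hn hloop, payoff_update hn hloop, hs, hy, hq, (hv i).deriv_demand hη,
        ← hy]
      ring
    · rw [replyDemand]
      ring
  ext a
  simp only [bestResponses, Set.mem_ofPred_eq, Set.mem_singleton_iff]
  constructor
  · intro ha
    obtain ⟨x, hx, hax⟩ := key a
    have h1 := ha (D.reply v m i)
    have hsum : 0 ≤ ∑ r ∈ Finset.univ.erase i, (a.2 r - D.ξ * D.target m i r) ^ 2 :=
      Finset.sum_nonneg fun _ _ => sq_nonneg _
    have hsq := sq_nonneg (a.2 i - D.ξ * a.1)
    have htan := (hv i).le_tangent hη (demand (v i) (D.price m i)) x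
    have hx0 : x = demand (v i) (D.price m i) := by
      by_contra hne
      have := (hv i).lt_tangent hη hne
      linarith
    have hy : a.1 = D.replyDemand v m i := by rw [hax, hx0]; ring
    have hi : a.2 i = D.ξ * a.1 := by
      have : (a.2 i - D.ξ * a.1) ^ 2 = 0 := by linarith
      have := pow_eq_zero_iff two_ne_zero |>.1 this
      linarith
    have hsum0 : ∑ r ∈ Finset.univ.erase i, (a.2 r - D.ξ * D.target m i r) ^ 2 = 0 := by
      linarith
    refine Prod.ext hy (funext fun r => ?_)
    by_cases hr : r = i
    · subst hr
      simp [reply, hi, hy]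
    · have := (Finset.sum_eq_zero_iff_of_nonneg fun _ _ => sq_nonneg _).1 hsum0 r
        (Finset.mem_erase.2 ⟨hr, Finset.mem_univ _⟩)
      have := pow_eq_zero_iff two_ne_zero |>.1 this
      simp only [reply, if_neg hr]
      linarith
  · rintro rfl b
    obtain ⟨x, hx, -⟩ := key b
    have hsum : 0 ≤ ∑ r ∈ Finset.univ.erase i, (b.2 r - D.ξ * D.target m i r) ^ 2 :=
      Finset.sum_nonneg fun _ _ => sq_nonneg _
    have hsq := sq_nonneg (b.2 i - D.ξ * b.1)
    have htan := (hv i).le_tangent hη (demand (v i) (D.price m i)) x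
    linarith

theorem differentiable_reply (hloop : ∀ i, ¬ D.G.Adj i i)
    (hη : 0 < η) {v : Fin N → ℝ → ℝ} (hv : ∀ i, IsValuation η (v i)) :
    Differentiable ℝ (D.reply v) := by
  have hrep : ∀ i, Differentiable ℝ fun m => D.reports m i := fun i => by
    unfold reports
    fun_prop
  have hprice : ∀ i, Differentiable ℝ fun m => D.price m i := fun i => by
    simp only [price_eq hloop]
    have := hrep i
    unfold echo
    fun_prop
  have hy : ∀ i, Differentiable ℝ fun m => D.replyDemand v m i := fun i => by
    have h1 := hrep i
    have h2 := ((hv i).differentiable_demand hη).comp (hprice i)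
    unfold replyDemand
    exact (h2.add (h1.const_mul _)).sub_const _
  refine differentiable_pi.2 fun i => (hy i).prodMk (differentiable_pi.2 fun r => ?_)
  have := hy i
  unfold target
  split_ifs <;> fun_prop

/-- The change of the best-response demand between two profiles; `-s` is the difference quotient of
the demand function of `i` between the two prices. -/
theorem replyDemand_sub (hloop : ∀ i, ¬ D.G.Adj i i)
    (hη : 0 < η) {v : Fin N → ℝ → ℝ} (hv : ∀ i, IsValuation η (v i)) (x y : Profile N)
    (i : Fin N) : ∃ s ∈ Set.Ioo (1 / η) η,
      D.replyDemand v x i - D.replyDemand v y i =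
        -(s / D.δ) * D.echo (x - y) i + (1 / ((N : ℝ) - 1) - s / D.δ) * D.reports (x - y) i := by
  obtain ⟨s, hs, he⟩ := (hv i).demand_slope hη (D.price y i) (D.price x i)
  refine ⟨s, hs, ?_⟩
  have hr : D.reports (x - y) i = D.reports x i - D.reports y i := by
    simp only [reports, ← Finset.sum_sub_distrib, ← sub_div]
    rfl
  have ht : D.echo (x - y) i = D.echo x i - D.echo y i := by
    simp only [echo, ← sub_div]
    rfl
  rw [price_eq hloop, price_eq hloop] at he
  rw [replyDemand, replyDemand, price_eq hloop, price_eq hloop, hr, ht]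
  linear_combination he

theorem target_sub (x y : Profile N) (i r : Fin N) :
    D.target (x - y) i r = D.target x i r - D.target y i r := by
  unfold target
  split_ifs <;> rfl

theorem abs_fst_le (x : Profile N) (j : Fin N) : |(x j).1| ≤ ‖x‖ :=
  (norm_fst_le (x j)).trans (norm_le_pi_norm x j)

theorem abs_snd_le (x : Profile N) (j r : Fin N) : |(x j).2 r| ≤ ‖x‖ :=
  (norm_le_pi_norm (x j).2 r).trans ((norm_snd_le (x j)).trans (norm_le_pi_norm x j))

/-! ### Contraction with at least three agents -/

/-- If all messages travel at most `K` steps, the row of `y_i` has sum at most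
`ξ⁻ᴷ (γ + (N - 1) (1 / (N - 1) - γ))`, where `γ = s / δ` is at most `1 / (N - 1)`; this equals
`ξ⁻ᴷ (1 - (N - 2) γ)`. -/
theorem norm_reply_sub_le (hN : 3 ≤ N) (hloop : ∀ i, ¬ D.G.Adj i i)
    (hη : 0 < η) {v : Fin N → ℝ → ℝ} (hv : ∀ i, IsValuation η (v i))
    (hδ : 0 < D.δ) (hδη : η / D.δ ≤ 1 / ((N : ℝ) - 1)) (hξ : 0 < D.ξ) (hξ1 : D.ξ < 1)
    {K : ℕ} (hK1 : 1 ≤ K) (hK : ∀ i r, D.hops i r ≤ K) (x y : Profile N) :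
    ‖D.reply v x - D.reply v y‖ ≤ max D.ξ ((1 - 1 / η / D.δ) / D.ξ ^ K) * ‖x - y‖ := by
  have hN' : (0 : ℝ) < (N : ℝ) - 1 := by
    have : (3 : ℝ) ≤ N := by exact_mod_cast hN
    linarith
  have hpow : ∀ k ≤ K, ∀ a : ℝ, |a| ≤ ‖x - y‖ → |a / D.ξ ^ k| ≤ ‖x - y‖ / D.ξ ^ K := by
    intro k hk a ha
    rw [abs_div, abs_of_pos (pow_pos hξ k)]
    exact div_le_div₀ (norm_nonneg _) ha (pow_pos hξ K) (pow_le_pow_of_le_one hξ.le hξ1.le hk)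
  have hy : ∀ i, |D.replyDemand v x i - D.replyDemand v y i| ≤
      (1 - 1 / η / D.δ) / D.ξ ^ K * ‖x - y‖ := by
    intro i
    obtain ⟨s, hs, he⟩ := replyDemand_sub hloop hη hv x y i
    have hγ1 : 1 / η / D.δ ≤ s / D.δ := div_le_div_of_nonneg_right hs.1.le hδ.le
    have hγ2 : s / D.δ ≤ 1 / ((N : ℝ) - 1) := (div_le_div_of_nonneg_right hs.2.le hδ.le).trans hδη
    have hγ0 : 0 < 1 / η / D.δ := by positivity
    set γ := s / D.δ
    have hecho : |D.echo (x - y) i| ≤ ‖x - y‖ / D.ξ ^ K := by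
      simpa [echo] using hpow 1 hK1 _ (abs_snd_le (x - y) (D.n i i) i)
    have hrep : |D.reports (x - y) i| ≤ ((N : ℝ) - 1) * (‖x - y‖ / D.ξ ^ K) := by
      refine (Finset.abs_sum_le_sum_abs _ _).trans ?_
      refine (Finset.sum_le_card_nsmul _ _ (‖x - y‖ / D.ξ ^ K) fun r _ =>
        hpow _ (hK i r) _ (abs_snd_le _ _ _)).trans_eq ?_
      rw [Finset.card_erase_of_mem (Finset.mem_univ i), Finset.card_univ, Fintype.card_fin,
        nsmul_eq_mul, Nat.cast_sub (by omega), Nat.cast_one]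
    have hb : 0 ≤ ‖x - y‖ / D.ξ ^ K := by positivity
    set B := ‖x - y‖ / D.ξ ^ K
    calc |D.replyDemand v x i - D.replyDemand v y i|
        ≤ γ * |D.echo (x - y) i| + (1 / ((N : ℝ) - 1) - γ) * |D.reports (x - y) i| := by
          rw [he]
          refine (abs_add_le _ _).trans_eq ?_
          rw [abs_mul, abs_mul, abs_neg, abs_of_pos (hγ0.trans_le hγ1),
            abs_of_nonneg (by linarith : 0 ≤ 1 / ((N : ℝ) - 1) - γ)]
      _ ≤ γ * B + (1 / ((N : ℝ) - 1) - γ) * (((N : ℝ) - 1) * B) :=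
          add_le_add (mul_le_mul_of_nonneg_left hecho (hγ0.trans_le hγ1).le)
            (mul_le_mul_of_nonneg_left hrep (by linarith))
      _ = (1 - ((N : ℝ) - 2) * γ) * B := by
          field_simp
          ring
      _ ≤ (1 - 1 / η / D.δ) * B := by
          refine mul_le_mul_of_nonneg_right ?_ hb
          have : (3 : ℝ) ≤ N := by exact_mod_cast hN
          nlinarith
      _ = (1 - 1 / η / D.δ) / D.ξ ^ K * ‖x - y‖ := by
          simp only [B]
          ring
  set κ := max D.ξ ((1 - 1 / η / D.δ) / D.ξ ^ K)
  have hκ : 0 ≤ κ := hξ.le.trans (le_max_left _ _)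
  have hy' : ∀ i, |D.replyDemand v x i - D.replyDemand v y i| ≤ κ * ‖x - y‖ := fun i =>
    (hy i).trans (mul_le_mul_of_nonneg_right (le_max_right _ _) (norm_nonneg _))
  have hb : 0 ≤ κ * ‖x - y‖ := by positivity
  refine (pi_norm_le_iff_of_nonneg hb).2 fun i => max_le (hy' i)
    ((pi_norm_le_iff_of_nonneg hb).2 fun r => ?_)
  change |D.ξ * (if r = i then D.replyDemand v x i else D.target x i r) -
    D.ξ * (if r = i then D.replyDemand v y i else D.target y i r)| ≤ _
  rw [← mul_sub, abs_mul, abs_of_pos hξ]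
  split_ifs with hr
  · exact (mul_le_of_le_one_left (abs_nonneg _) hξ1.le).trans (hy' i)
  · rw [← target_sub]
    refine mul_le_mul (le_max_left _ _) ?_ (abs_nonneg _) hκ
    unfold target
    split_ifs
    · exact abs_fst_le _ _
    · exact abs_snd_le _ _ _

/-! ### Contraction with two agents -/

/-- The coordinates whose sup norm makes the best-response map of two agents a contraction:
`4 (ξ y_i - q_i^i)`, `q_i^i`, and the differences `q_i^i - q_i^r`. -/
noncomputable def pairCoords (ξ : ℝ) (hξ : ξ ≠ 0) : Profile N ≃ₗ[ℝ] Profile N where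
  toFun m i := (4 * (ξ * (m i).1 - (m i).2 i),
    fun r => if r = i then (m i).2 i else (m i).2 i - (m i).2 r)
  invFun m i := ((m i).1 / (4 * ξ) + (m i).2 i / ξ,
    fun r => if r = i then (m i).2 i else (m i).2 i - (m i).2 r)
  map_add' x y := by
    funext i
    refine Prod.ext ?_ (funext fun r => ?_)
    · simp only [Pi.add_apply, Prod.fst_add, Prod.snd_add]
      ring
    · simp only [Pi.add_apply, Prod.snd_add]
      split_ifs <;> ring
  map_smul' a x := by
    funext i
    refine Prod.ext ?_ (funext fun r => ?_)
    · simp only [Pi.smul_apply, Prod.smul_fst, Prod.smul_snd, smul_eq_mul, RingHom.id_apply]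
      ring
    · simp only [Pi.smul_apply, Prod.smul_snd, smul_eq_mul, RingHom.id_apply]
      split_ifs <;> ring
  left_inv m := by
    funext i
    refine Prod.ext ?_ (funext fun r => ?_)
    · simp only [if_true]
      field_simp
      ring
    · by_cases hr : r = i
      · simp [hr]
      · simp [hr]
  right_inv m := by
    funext i
    refine Prod.ext ?_ (funext fun r => ?_)
    · simp only [if_true]
      field_simp
      ring
    · by_cases hr : r = i
      · simp [hr]
      · simp [hr]

/-- With `s = q_j^j`, `e = q_j^j - q_j^i`, `f = ξ y_j - q_j^j` for the opponent `j` of `i`, and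
`γ ≤ 1 / 6`, the best response has `q_i^i = (1 - 2 γ) s + γ e` and
`q_i^i - q_i^j = -f - 2 γ s + γ e`, while `ξ y_i - q_i^i = 0`. -/
theorem norm_pairCoords_reply_sub_le (hN : N = 2) (hn : IsNextHop D.G D.n)
    (hloop : ∀ i, ¬ D.G.Adj i i)
    (hη : 0 < η) {v : Fin N → ℝ → ℝ} (hv : ∀ i, IsValuation η (v i))
    (hδ : 0 < D.δ) (hδη : η / D.δ ≤ 1 / 6) (hξ : D.ξ ≠ 0) (x y : Profile N) :
    ‖pairCoords D.ξ hξ (D.reply v x - D.reply v y)‖ ≤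
      max (3 / 4) (1 - 1 / η / D.δ) * ‖pairCoords D.ξ hξ (x - y)‖ := by
  subst hN
  set M := ‖pairCoords D.ξ hξ (x - y)‖
  set κ := max (3 / 4 : ℝ) (1 - 1 / η / D.δ)
  have hM : 0 ≤ M := norm_nonneg _
  have hκ : 0 ≤ κ := le_trans (by norm_num) (le_max_left _ _)
  have hb : 0 ≤ κ * M := mul_nonneg hκ hM
  refine (pi_norm_le_iff_of_nonneg hb).2 fun i => ?_
  obtain ⟨j, hj, hall⟩ : ∃ j : Fin 2, j ≠ i ∧ ∀ r, r ≠ i → r = j :=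
    ⟨1 - i, by fin_cases i <;> decide, by fin_cases i <;> decide⟩
  have hnext : ∀ r, D.n i r = j := fun r => hall _ (next_ne hn hloop i r)
  have hadj : D.G.Adj i j := by simpa only [hnext] using hn.adj i i
  have herase : (Finset.univ : Finset (Fin 2)).erase i = {j} := by
    ext r
    simp only [Finset.mem_erase, Finset.mem_univ, and_true, Finset.mem_singleton]
    exact ⟨hall r, fun h => h ▸ hj⟩
  obtain ⟨s, hs, he⟩ := replyDemand_sub hloop hη hv x y i
  have hγ1 : 1 / η / D.δ ≤ s / D.δ := div_le_div_of_nonneg_right hs.1.le hδ.le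
  have hγ2 : s / D.δ ≤ 1 / 6 := (div_le_div_of_nonneg_right hs.2.le hδ.le).trans hδη
  have hγ0 : 0 < 1 / η / D.δ := by positivity
  have hrep : D.reports (x - y) i = ((x - y) j).2 j / D.ξ := by
    rw [reports, herase, Finset.sum_singleton, source, hops, if_pos hadj, if_pos hadj, pow_one]
  have hecho : D.echo (x - y) i = ((x - y) j).2 i / D.ξ := by rw [echo, hnext]
  have htar : D.target x i j - D.target y i j = ((x - y) j).1 := by
    rw [← target_sub, target, if_pos hadj]
  have hf : |4 * (D.ξ * ((x - y) j).1 - ((x - y) j).2 j)| ≤ M :=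
    abs_fst_le (pairCoords D.ξ hξ (x - y)) j
  have hs1 : |((x - y) j).2 j| ≤ M := by
    have h := abs_snd_le (pairCoords D.ξ hξ (x - y)) j j
    rwa [show (pairCoords D.ξ hξ (x - y) j).2 j = ((x - y) j).2 j from if_pos rfl] at h
  have he1 : |((x - y) j).2 j - ((x - y) j).2 i| ≤ M := by
    have h := abs_snd_le (pairCoords D.ξ hξ (x - y)) j i
    rwa [show (pairCoords D.ξ hξ (x - y) j).2 i = ((x - y) j).2 j - ((x - y) j).2 i from
      if_neg hj.symm] at h
  rw [hrep, hecho] at he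
  set γ := s / D.δ
  set a := ((x - y) j).2 j
  set b := ((x - y) j).2 i
  set w := ((x - y) j).1
  have hW : D.ξ * (D.replyDemand v x i - D.replyDemand v y i) = (1 - 2 * γ) * a + γ * (a - b) := by
    rw [he]
    field_simp
    push_cast
    ring
  rw [abs_le] at hf hs1 he1
  have hi : |D.ξ * (D.replyDemand v x i - D.replyDemand v y i)| ≤ κ * M := by
    refine le_trans ?_ (mul_le_mul_of_nonneg_right (le_max_right _ _) hM)
    rw [hW, abs_le]
    constructor <;> nlinarith
  refine max_le ?_ ((pi_norm_le_iff_of_nonneg hb).2 fun r => ?_)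
  · have : (pairCoords D.ξ hξ (D.reply v x - D.reply v y) i).1 = 0 := by
      simp [pairCoords, reply]
      ring
    rw [this, norm_zero]
    exact hb
  · by_cases hr : r = i
    · have : (pairCoords D.ξ hξ (D.reply v x - D.reply v y) i).2 r =
          D.ξ * (D.replyDemand v x i - D.replyDemand v y i) := by
        simp [pairCoords, reply, hr]
        ring
      rw [this]
      exact hi
    · have hrj := hall r hr
      subst hrj
      have : (pairCoords D.ξ hξ (D.reply v x - D.reply v y) i).2 r =
          D.ξ * (D.replyDemand v x i - D.replyDemand v y i) - D.ξ * w := by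
        rw [← htar]
        simp [pairCoords, reply, hr]
        ring
      rw [this, hW]
      refine le_trans ?_ (mul_le_mul_of_nonneg_right (le_max_left _ _) hM)
      rw [Real.norm_eq_abs, abs_le]
      constructor <;> nlinarith

/-! ### Monotonicity in the reported own demand -/

theorem reports_setProxy (D : Design N) (m : Profile N) (i j : Fin N) (t : ℝ) :
    D.reports (setProxy m j i t) i = D.reports m i := by
  refine Finset.sum_congr rfl fun r hr => ?_
  have hr := Finset.ne_of_mem_erase hr
  by_cases h : D.source i r = j
  · simp [setProxy, h, Function.update_of_ne hr]
  · simp [setProxy, Function.update_of_ne h]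

theorem echo_setProxy (D : Design N) (m : Profile N) (i : Fin N) (t : ℝ) :
    D.echo (setProxy m (D.n i i) i t) i = t / D.ξ := by
  simp [echo, setProxy]

theorem strictMono_price_setProxy (hloop : ∀ i, ¬ D.G.Adj i i) (hδ : 0 < D.δ) (hξ : 0 < D.ξ)
    (m : Profile N) (i : Fin N) :
    StrictMono fun t => D.price (setProxy m (D.n i i) i t) i := by
  intro a b hab
  simp only [price_eq hloop, reports_setProxy, echo_setProxy]
  have := div_lt_div_of_pos_right hab hξ
  exact mul_lt_mul_of_pos_left (by linarith) (by positivity)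

theorem strictAnti_replyDemand (hloop : ∀ i, ¬ D.G.Adj i i) (hδ : 0 < D.δ) (hξ : 0 < D.ξ)
    (hη : 0 < η) {v : Fin N → ℝ → ℝ} (hv : ∀ i, IsValuation η (v i)) (m : Profile N) (i : Fin N) :
    StrictAnti fun t => D.replyDemand v (setProxy m (D.n i i) i t) i := by
  intro a b hab
  simp only [replyDemand, reports_setProxy]
  have := (hv i).strictAnti_demand hη (strictMono_price_setProxy hloop hδ hξ m i hab)
  simp only at this
  linarith

theorem setProxy_mono (m : Profile N) (j r : Fin N) : Monotone (setProxy m j r) := by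
  intro a b hab
  exact update_le_update_iff'.2 ⟨le_rfl, update_le_update_iff'.2 hab⟩

theorem not_bestResponseNondecreasing (hN : 0 < N) (hn : IsNextHop D.G D.n)
    (hloop : ∀ i, ¬ D.G.Adj i i) (hδ : 0 < D.δ) (hξ : 0 < D.ξ)
    (hη : 0 < η) {v : Fin N → ℝ → ℝ} (hv : ∀ i, IsValuation η (v i)) :
    ¬ BestResponseNondecreasing (D.reply v) := by
  intro h
  let i : Fin N := ⟨0, hN⟩
  have h1 := (h i (D.n i i) (next_ne hn hloop i i) 0 (0, Function.update 0 i 0)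
    (0, Function.update 0 i 1)
    ⟨le_rfl, update_le_update_iff'.2 zero_le_one⟩).1
  exact absurd h1 (not_le.2 (strictAnti_replyDemand hloop hδ hξ hη hv 0 i zero_lt_one))

/-- A higher report of `i`'s demand raises the price, and so lowers the gain of `i` from a higher
demand: increasing differences fail. -/
theorem not_isSupermodular (hN : 0 < N) (hn : IsNextHop D.G D.n)
    (hloop : ∀ i, ¬ D.G.Adj i i) (hδ : 0 < D.δ) (hξ : 0 < D.ξ) (v : Fin N → ℝ → ℝ) :
    ¬ IsSupermodular (D.payoff v) := by
  intro h
  let i : Fin N := ⟨0, hN⟩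
  have hp := strictMono_price_setProxy hloop hδ hξ 0 i zero_lt_one
  have h1 := (h i).2 _ _ (setProxy_mono 0 (D.n i i) i zero_le_one) (0, 0) (1, 0)
    ⟨zero_le_one, le_rfl⟩
  have ht : ∀ t, ∀ r ∈ Finset.univ.erase i,
      D.target (setProxy 0 (D.n i i) i t) i r = D.target 0 i r := by
    intro t r hr
    have hr := Finset.ne_of_mem_erase hr
    unfold target
    split_ifs
    · by_cases h : r = D.n i i
      · simp [setProxy, ← h]
      · simp [setProxy, Function.update_of_ne h]
    · by_cases h : D.n i r = D.n i i
      · simp [setProxy, h, Function.update_of_ne hr]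
      · simp [setProxy, Function.update_of_ne h]
  have hsum : ∀ t (q : Fin N → ℝ), ∑ r ∈ Finset.univ.erase i,
      (q r - D.ξ * D.target (setProxy 0 (D.n i i) i t) i r) ^ 2 =
      ∑ r ∈ Finset.univ.erase i, (q r - D.ξ * D.target 0 i r) ^ 2 := fun t q =>
    Finset.sum_congr rfl fun r hr => by rw [ht t r hr]
  simp only [payoff_update hn hloop, reports_setProxy, hsum] at h1
  simp only at hp
  linarith

/-! ### The equilibrium -/

theorem isNash_iff {u : Fin N → Profile N → ℝ} {β : Profile N → Profile N}
    (h : IsBestResponseMap u β) (m : Profile N) : IsNash u m ↔ β m = m := by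
  have key : ∀ i, (∀ b, u i (Function.update m i b) ≤ u i m) ↔ m i = β m i := fun i => by
    rw [← Set.mem_singleton_iff, ← h i m, bestResponses, Set.mem_ofPred_eq,
      Function.update_eq_self]
  simp only [IsNash, key, funext_iff, eq_comm]

/-- In equilibrium the proxy for the demand of `r` is discounted once per step on the way. -/
theorem proxy_eq_of_reply_eq (hn : IsNextHop D.G D.n) {v : Fin N → ℝ → ℝ} {z : Profile N}
    (hz : D.reply v z = z) (k : ℕ) : ∀ i r, r ≠ i → ddist D.G i r = k →
      (z i).2 r = D.ξ ^ k * (z r).1 := by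
  have hq : ∀ i r, r ≠ i → (z i).2 r = D.ξ * D.target z i r := fun i r hr => by
    conv_lhs => rw [← hz]
    simp [reply, hr]
  induction k with
  | zero =>
    intro i r hr hd
    have := hn.dist_succ i r hr
    omega
  | succ k ih =>
    intro i r hr hd
    rw [hq i r hr, target]
    split_ifs with h
    · have h1 : ddist D.G i r ≤ 1 := Nat.sInf_le ⟨r, h, rfl⟩
      have : k = 0 := by omega
      simp [this]
    · have hs := hn.dist_succ i r hr
      rw [ih (D.n i r) r (fun he => h (he ▸ hn.adj i r)) (by omega)]
      ring

theorem reports_eq_of_reply_eq (hn : IsNextHop D.G D.n) (hξ : D.ξ ≠ 0) {v : Fin N → ℝ → ℝ}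
    {z : Profile N} (hz : D.reply v z = z) (i : Fin N) :
    D.reports z i = ∑ r, (z r).1 - (z i).1 := by
  rw [← Finset.sum_erase_eq_sub (Finset.mem_univ i)]
  refine Finset.sum_congr rfl fun r hr => ?_
  have hr := Finset.ne_of_mem_erase hr
  unfold source hops
  split_ifs with h
  · have : (z r).2 r = D.ξ * (z r).1 := by
      conv_lhs => rw [← hz]
      conv_rhs => rw [← hz]
      simp [reply]
    rw [this]
    field_simp
  · have hs := hn.dist_succ i r hr
    rw [proxy_eq_of_reply_eq hn hz _ (D.n i r) r (fun he => h (he ▸ hn.adj i r)) rfl, ← hs,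
      Nat.add_sub_cancel]
    field_simp

/-- If every agent's demand is echoed by an agent who observes it, then in equilibrium all agents
face the same price, so that marginal valuations are equal, and the demands are rationed to the
available amount. -/
theorem isEfficient_iff_of_reply_eq (hN : 2 ≤ N) (hn : IsNextHop D.G D.n)
    (hloop : ∀ i, ¬ D.G.Adj i i) (hξ : D.ξ ≠ 0) (hη : 0 < η) {v : Fin N → ℝ → ℝ}
    (hv : ∀ i, IsValuation η (v i)) {z : Profile N} (hz : D.reply v z = z)
    (hback : ∀ i, D.G.Adj (D.n i i) i) (x : Fin N → ℝ) :
    IsEfficient D.c v x ↔ x = D.alloc z := by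
  have hN2 : (2 : ℝ) ≤ N := by exact_mod_cast hN
  have hN1 : (N : ℝ) - 1 ≠ 0 := by linarith
  have hN0 : (N : ℝ) ≠ 0 := by linarith
  have hecho : ∀ i, D.echo z i = (z i).1 := fun i => by
    have h : (z (D.n i i)).2 i = D.ξ * (z i).1 := by
      conv_lhs => rw [← hz]
      simp [reply, (next_ne hn hloop i i).symm, target, hback i]
    rw [echo, h]
    field_simp
  have hprice : ∀ i, D.price z i = 1 / D.δ * ∑ r, (z r).1 := fun i => by
    rw [price_eq hloop, hecho, reports_eq_of_reply_eq hn hξ hz]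
    ring
  refine isEfficient_iff_of_deriv_eq hv hη (p := 1 / D.δ * ∑ r, (z r).1) ?_ (fun i => ?_) x
  · simp only [alloc_eq hloop, reports_eq_of_reply_eq hn hξ hz, Finset.sum_add_distrib,
      Finset.sum_sub_distrib, ← Finset.mul_sum, Finset.sum_const, Finset.card_univ,
      Fintype.card_fin, nsmul_eq_mul]
    field_simp
    ring
  · have : D.alloc z i = demand (v i) (D.price z i) := by
      have h1 : (z i).1 = D.replyDemand v z i := by
        conv_lhs => rw [← hz]
        rfl
      rw [alloc_eq hloop, h1, replyDemand]
      ring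
    rw [this, (hv i).deriv_demand hη, hprice]

/-! ### Choice of the parameters -/

theorem exists_hops_bound (D : Design N) :
    ∃ K : ℕ, 1 ≤ K ∧ ∀ i r, D.hops i r ≤ K := by
  refine ⟨1 + ∑ i, ∑ r, D.hops i r, by omega, fun i r => ?_⟩
  have h1 : D.hops i r ≤ ∑ r, D.hops i r :=
    Finset.single_le_sum (f := fun r => D.hops i r) (fun _ _ => Nat.zero_le _) (Finset.mem_univ r)
  have h2 : ∑ r, D.hops i r ≤ ∑ i, ∑ r, D.hops i r :=
    Finset.single_le_sum (f := fun i => ∑ r, D.hops i r) (fun _ _ => Nat.zero_le _)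
      (Finset.mem_univ i)
  omega

end Design

theorem exists_lt_pow {a : ℝ} (ha : 0 < a) (ha1 : a < 1) (K : ℕ) :
    ∃ ξ₀ ∈ Set.Ioo (0 : ℝ) 1, ∀ ξ ∈ Set.Ioo ξ₀ 1, 1 - a < ξ ^ K := by
  have hK : (0 : ℝ) < K + 1 := by positivity
  have h1 : a / (K + 1) ≤ a := div_le_self ha.le (by linarith [Nat.cast_nonneg (α := ℝ) K])
  have h0 : 0 < a / (K + 1) := by positivity
  -- Bernoulli's inequality gives `ξ ^ K ≥ 1 - K (1 - ξ) > 1 - a`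
  refine ⟨1 - a / (K + 1), ⟨by linarith, by linarith⟩, fun ξ hξ => ?_⟩
  have hb := one_add_mul_le_pow (a := ξ - 1) (by linarith [hξ.1]) K
  rw [add_sub_cancel] at hb
  have h2 : (K : ℝ) * (1 - ξ) ≤ K * (a / (K + 1)) :=
    mul_le_mul_of_nonneg_left (by linarith [hξ.1]) (Nat.cast_nonneg K)
  have h3 : (K : ℝ) * (a / (K + 1)) = a - a / (K + 1) := by
    field_simp
    ring
  linarith

/-- The consequences of the contraction property that are the same for two agents and for more: the
contraction may be with respect to the sup norm in any linear coordinates `L`. -/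
theorem Design.properties_of_isContraction (hN : 2 ≤ N) {D : Design N}
    (hn : IsNextHop D.G D.n) (hloop : ∀ i, ¬ D.G.Adj i i) (hδ : 0 < D.δ) (hξ : 0 < D.ξ)
    (hη : 0 < η) {v : Fin N → ℝ → ℝ} (hv : ∀ i, IsValuation η (v i))
    {L : Profile N ≃L[ℝ] Profile N} {p : Seminorm ℝ (Profile N)} (hp : ∀ x, p x = ‖L x‖)
    (hc : IsContraction p (D.reply v)) :
    (∀ i m, StrictAnti fun t => (D.reply v (setProxy m (D.n i i) i t) i).1) ∧
      (∀ i m, StrictAnti fun t => (D.reply v (setProxy m (D.n i i) i t) i).2 i) ∧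
      ¬ BestResponseNondecreasing (D.reply v) ∧ ¬ IsSupermodular (D.payoff v) ∧
      ∃ z : Profile N, (∀ m, IsNash (D.payoff v) m ↔ m = z) ∧
        ((∀ i, D.G.Adj (D.n i i) i) → ∀ x, IsEfficient D.c v x ↔ x = D.alloc z) ∧
        ∀ (μ : ℕ → Fin N → ProbabilityMeasure (Message N)) (m : ℕ → Profile N),
          IsABR p (D.reply v) z μ m →
            Tendsto m atTop (𝓝 z) ∧ ∀ U ∈ 𝓝 z, ∀ᶠ k in atTop, mixedSupport (μ k) ⊆ U := by
  have hy := strictAnti_replyDemand hloop hδ hξ hη hv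
  obtain ⟨z, hz⟩ := hc.exists_fixedPoint hp
  have hzz : D.reply v z = z := (hz z).2 rfl
  refine ⟨fun i m => hy m i, fun i m a b hab => ?_,
    not_bestResponseNondecreasing (by omega) hn hloop hδ hξ hη hv,
    not_isSupermodular (by omega) hn hloop hδ hξ v, z,
    fun m => (isNash_iff (isBestResponseMap_reply hn hloop hη hv) m).trans (hz m),
    isEfficient_iff_of_reply_eq hN hn hloop hξ.ne' hη hv hzz, fun μ m h => ?_⟩
  · simpa [reply] using mul_lt_mul_of_pos_left (hy m i hab) hξ
  · obtain ⟨κ, hκ, hκ1, hβ⟩ := hc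
    refine h.tendsto hp hκ hκ1 fun x => ?_
    simpa only [hzz] using hβ x z

end PrivateGoods

open PrivateGoods in
theorem mainTheorem3 {N : ℕ} (hN : 2 ≤ N)
    (G : Digraph (Fin N)) (hloop : ∀ i, ¬ G.Adj i i) (hG : PrivateGoods.StronglyConnected G)
    (n : Fin N → Fin N → Fin N) (hn : PrivateGoods.IsNextHop G n)
    (η : ℝ) (hη : 1 < η) :
    ∃ ξ₀ ∈ Set.Ioo (0 : ℝ) 1, ∀ ξ ∈ Set.Ioo ξ₀ 1, ∃ δ > 0,
    ∃ p : Seminorm ℝ (PrivateGoods.Profile N),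
      (∀ x, p x = 0 → x = 0) ∧
      (3 ≤ N → ∀ x, p x = ‖x‖) ∧
      ∀ (c : ℝ) (v : Fin N → ℝ → ℝ), (∀ i, PrivateGoods.IsValuation η (v i)) →
        ∃ β : PrivateGoods.Profile N → PrivateGoods.Profile N,
          PrivateGoods.IsBestResponseMap ((PrivateGoods.Design.mk G n c ξ δ).payoff v) β ∧
          PrivateGoods.IsContraction p β ∧
          Differentiable ℝ β ∧
          (3 ≤ N → ∃ κ < 1, ∀ m, PrivateGoods.jacobianRowSumNorm β m ≤ κ) ∧
          (∀ i m, StrictAnti fun t => (β (PrivateGoods.setProxy m (n i i) i t) i).1) ∧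
          (∀ i m, StrictAnti fun t => (β (PrivateGoods.setProxy m (n i i) i t) i).2 i) ∧
          ¬ PrivateGoods.BestResponseNondecreasing β ∧
          ¬ PrivateGoods.IsSupermodular ((PrivateGoods.Design.mk G n c ξ δ).payoff v) ∧
          ∃ z : PrivateGoods.Profile N,
            (∀ m, PrivateGoods.IsNash ((PrivateGoods.Design.mk G n c ξ δ).payoff v) m ↔ m = z) ∧
            ((∀ i, G.Adj (n i i) i) →
              ∀ x, PrivateGoods.IsEfficient c v x ↔ x = (PrivateGoods.Design.mk G n c ξ δ).alloc z) ∧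
            ∀ (μ : ℕ → Fin N → ProbabilityMeasure (PrivateGoods.Message N))
              (m : ℕ → PrivateGoods.Profile N), PrivateGoods.IsABR p β z μ m →
              Tendsto m atTop (𝓝 z) ∧
              ∀ U ∈ 𝓝 z, ∀ᶠ k in atTop, PrivateGoods.mixedSupport (μ k) ⊆ U := by
  have hη0 : 0 < η := by linarith
  have hN2 : (2 : ℝ) ≤ N := by exact_mod_cast hN
  have hN1 : 0 < (N : ℝ) - 1 := by linarith
  -- `η / δ`, the largest possible `γ`, is at most `1 / 6` for `N = 2`
  -- and at most `1 / (N - 1)` in general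
  set δ : ℝ := 6 * η * ((N : ℝ) - 1) with hδ_def
  have hδ : 0 < δ := by positivity
  have hδη : η / δ = 1 / 6 / ((N : ℝ) - 1) := by
    rw [hδ_def]
    field_simp
  have hγ0 : 0 < 1 / η / δ := by positivity
  have hγ1 : 1 / η / δ < 1 := by
    have h1 : 1 < δ := by nlinarith
    rw [div_div, div_lt_one (by positivity)]
    nlinarith
  obtain ⟨K, hK1, hK⟩ := Design.exists_hops_bound (Design.mk G n 0 0 0)
  obtain ⟨ξ₀, hξ₀, hpow⟩ := exists_lt_pow hγ0 hγ1 K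
  refine ⟨ξ₀, hξ₀, fun ξ hξ => ⟨δ, hδ, ?_⟩⟩
  have hξ0 : 0 < ξ := hξ₀.1.trans hξ.1
  rcases hN.eq_or_lt with hN' | hN'
  · let L := (Design.pairCoords (N := N) ξ hξ0.ne').toContinuousLinearEquiv
    refine ⟨(normSeminorm ℝ (Profile N)).comp L.toLinearMap, fun x hx => ?_,
      fun h => by omega, fun c v hv => ?_⟩
    · have : ‖L x‖ = 0 := hx
      simpa using this
    · let D := Design.mk G n c ξ δ
      have hc : IsContraction ((normSeminorm ℝ (Profile N)).comp L.toLinearMap) (D.reply v) := by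
        refine ⟨max (3 / 4) (1 - 1 / η / δ), le_max_of_le_left (by norm_num),
          max_lt (by norm_num) (by linarith),
          D.norm_pairCoords_reply_sub_le hN'.symm hn hloop hη0 hv hδ ?_ hξ0.ne'⟩
        change η / δ ≤ _
        rw [hδη, ← hN']
        norm_num
      exact ⟨D.reply v, D.isBestResponseMap_reply hn hloop hη0 hv, hc,
        D.differentiable_reply hloop hη0 hv, fun h => by omega,
        D.properties_of_isContraction hN hn hloop hδ hξ0 hη0 hv (fun _ => rfl) hc⟩
  · refine ⟨normSeminorm ℝ (Profile N), fun x hx => by simpa using hx, fun _ _ => rfl,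
      fun c v hv => ?_⟩
    let D := Design.mk G n c ξ δ
    have hκ1 : max ξ ((1 - 1 / η / δ) / ξ ^ K) < 1 :=
      max_lt hξ.2 ((div_lt_one (by positivity)).2 (hpow ξ hξ))
    have hκ0 : 0 ≤ max ξ ((1 - 1 / η / δ) / ξ ^ K) := le_max_of_le_left hξ0.le
    have hlip := D.norm_reply_sub_le hN' hloop hη0 hv hδ
      (by
        change η / δ ≤ _
        rw [hδη]
        exact div_le_div_of_nonneg_right (by norm_num) hN1.le)
      hξ0 hξ.2 hK1 hK
    have hc : IsContraction (normSeminorm ℝ (Profile N)) (D.reply v) := ⟨_, hκ0, hκ1, hlip⟩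
    exact ⟨D.reply v, D.isBestResponseMap_reply hn hloop hη0 hv, hc,
      D.differentiable_reply hloop hη0 hv,
      fun _ => ⟨_, hκ1, jacobianRowSumNorm_le (by omega) hκ0 hlip⟩,
      D.properties_of_isContraction hN hn hloop hδ hξ0 hη0 hv
        (L := ContinuousLinearEquiv.refl ℝ _) (fun _ => rfl) hc⟩
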